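/- Let $0<\alpha<2$, $\tau>0$, $\nu>0$ be real and let $k\ge 1$ be an integer. Let $\mathcal P_n^{(a,b)}(x)=\sum_{s=0}^{n}\binom{n+a}{n-s}\binom{n+b}{s}\left(\frac{x-1}{2}\right)^{s}\left(\frac{x+1}{2}\right)^{n-s}$ denote the Jacobi polynomials, where $\binom{r}{m}=r(r-1)\cdots(r-m+1)/m!$ for real $r$. Let $\theta_1,\dots,\theta_k$ be the zeros of $\mathcal P_k^{(-\alpha/2,\,\alpha/2-1)}$ and $\zeta_1,\dots,\zeta_{k-1}$ the zeros of $\mathcal P_{k-1}^{(\alpha/2,\,1-\alpha/2)}$, and put $$\eta_j=\frac{\tau(1-\theta_j)}{1+\theta_j}\ (1\le j\le k),\qquad \epsilon_r=\frac{\tau(1-\zeta_r)}{1+\zeta_r}\ (1\le r\le k-1),\qquad \chi=\frac{1}{\tau^{\alpha/2}}\,\frac{\binom{k+\alpha/2-1}{k-1}}{\binom{k-\alpha/2}{k}}\,\frac{\prod_{j=1}^{k}\eta_j}{\prod_{r=1}^{k-1}\epsilon_r}.$$ Let $p_{k-1}(z)=\chi\prod_{r=1}^{k-1}(z+\epsilon_r)$,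 $q_k(z)=\prod_{j=1}^{k}(z+\eta_j)$ and $\tilde q_k=p_{k-1}+\nu q_k$. Then $\tilde q_k$ has degree $k$ and all of its complex roots are real, negative and simple. Consequently the $k$ Krylov poles, i.e. the opposites $-z$ of the roots $z$ of $\tilde q_k$, are real, positive and pairwise distinct. -/

import Mathlib

open Polynomial

noncomputable section

/-- The Jacobi polynomial `P_n^{(a,b)}` with real parameters `a`, `b`, in its standard normalization
`∑ s, C(n+a, n-s) C(n+b, s) ((x-1)/2)^s ((x+1)/2)^(n-s)`. The binomial coefficients have a real
upper argument: `Ring.choose r m = r (r-1) ⋯ (r-m+1) / m!`. -/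
def jacobiPoly (n : ℕ) (a b : ℝ) : ℝ[X] :=
  ∑ s ∈ Finset.range (n + 1),
    C (Ring.choose ((n : ℝ) + a) (n - s) * Ring.choose ((n : ℝ) + b) s) *
      (C (1 / 2) * (X - 1)) ^ s * (C (1 / 2) * (X + 1)) ^ (n - s)

/-- The Möbius map `x ↦ τ (1 - x) / (1 + x)`, applied to the Jacobi zeros. -/
def poleMap (τ x : ℝ) : ℝ := τ * (1 - x) / (1 + x)

/-- The numbers `η_1, …, η_k`: images of the zeros `θ_j` of `P_k^{(-α/2, α/2-1)}`
(all zeros, with multiplicity). -/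
def etas (α τ : ℝ) (k : ℕ) : Multiset ℝ :=
  (jacobiPoly k (-(α / 2)) (α / 2 - 1)).roots.map (poleMap τ)

/-- The numbers `ε_1, …, ε_{k-1}`: images of the zeros `ζ_r` of `P_{k-1}^{(α/2, 1-α/2)}`
(all zeros, with multiplicity). -/
def epsilons (α τ : ℝ) (k : ℕ) : Multiset ℝ :=
  (jacobiPoly (k - 1) (α / 2) (1 - α / 2)).roots.map (poleMap τ)

/-- The constant `χ = τ^{-α/2} · C(k+α/2-1, k-1) / C(k-α/2, k) · (∏ η_j) / (∏ ε_r)`. -/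
def chi (α τ : ℝ) (k : ℕ) : ℝ :=
  1 / τ ^ (α / 2) *
    (Ring.choose ((k : ℝ) + α / 2 - 1) (k - 1) / Ring.choose ((k : ℝ) - α / 2) k) *
    ((etas α τ k).prod / (epsilons α τ k).prod)

/-- The numerator `p_{k-1}(z) = χ ∏_{r=1}^{k-1} (z + ε_r)`. -/
def pPoly (α τ : ℝ) (k : ℕ) : ℝ[X] :=
  C (chi α τ k) * ((epsilons α τ k).map fun e => X + C e).prod

/-- The denominator `q_k(z) = ∏_{j=1}^{k} (z + η_j)`. -/
def qPoly (α τ : ℝ) (k : ℕ) : ℝ[X] :=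
  ((etas α τ k).map fun e => X + C e).prod

/-- The polynomial `q̃_k = p_{k-1} + ν q_k`. -/
def qTilde (α τ ν : ℝ) (k : ℕ) : ℝ[X] :=
  pPoly α τ k + C ν * qPoly α τ k

/-- The Krylov poles attached to `q̃_k`: the opposites of its complex roots, with multiplicity. -/
def krylovPoles (α τ ν : ℝ) (k : ℕ) : Multiset ℂ :=
  ((qTilde α τ ν k).map (algebraMap ℝ ℂ)).roots.map fun z => -z

end

/-! The substitution `z = (x-1)/(x+1)` turns a Jacobi polynomial into the hypergeometric polynomial
`jacobiRev`, and `poleMap τ x` is then `-τ z`. Hence, with `b = α/2` and `k = m + 1`, q is a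
positive multiple of `A(z/τ)` and p of `B(z/τ)`, where `A`, `B` are as in `jacobiRev_wronskian`.

The engine is `HasSimpleNegRoots.of_derivative_mul_neg`: if `F` has the sign opposite to `G'` at
each root of `G`, sign changes yield all roots of `F`. It is used twice: by induction on the degree
for `jacobiRev`, and to pass from p to p + νq.

At a root of p only νq survives, so the second use needs `B' A < 0` at the negative roots of `B`.
Now `A` and `z^b B` solve the same hypergeometric equation; Abel's formula makes their Wronskian an
explicit multiple of a power of `1 - z`, which fixes the sign. -/

/-- `F` has positive leading coefficient, degree `n`, and `n` distinct negative real roots. -/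
def HasSimpleNegRoots (n : ℕ) (F : ℝ[X]) : Prop :=
  ∃ c : ℝ, 0 < c ∧ ∃ y : Fin n → ℝ, StrictMono y ∧ (∀ i, y i < 0) ∧
    F = C c * ∏ i, (X - C (y i))

/-! ### Locating roots by sign changes. -/

/-- Exactly the `n - 1 - i` factors with `j > i` are negative. -/
lemma neg_one_pow_mul_prod_sub_pos {n : ℕ} {y : Fin n → ℝ} (hy : StrictMono y) (i : Fin n) :
    0 < (-1 : ℝ) ^ (n - 1 - (i : ℕ)) * ∏ j ∈ Finset.univ.erase i, (y i - y j) := by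
  have h : ∏ j ∈ Finset.univ.erase i, (if i < j then (-1 : ℝ) else 1) =
      (-1) ^ (n - 1 - (i : ℕ)) := by
    rw [Finset.prod_ite, Finset.prod_const, Finset.prod_const_one, mul_one, ← Fin.card_Ioi]
    congr 2
    ext j
    simp only [Finset.mem_filter, Finset.mem_erase, Finset.mem_univ, and_true, Finset.mem_Ioi]
    exact ⟨fun h => h.2, fun h => ⟨h.ne', h⟩⟩
  rw [← h, ← Finset.prod_mul_distrib]
  refine Finset.prod_pos fun j hj => ?_
  have hji : j ≠ i := (Finset.mem_erase.1 hj).1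
  split_ifs with hij
  · have := hy hij
    linarith
  · have := hy (lt_of_le_of_ne (not_lt.1 hij) hji)
    linarith

lemma eval_derivative_prod_X_sub_C {n : ℕ} (c : ℝ) (y : Fin n → ℝ) (i : Fin n) :
    (derivative (C c * ∏ i, (X - C (y i)))).eval (y i) =
      c * ∏ j ∈ Finset.univ.erase i, (y i - y j) := by
  have := Lagrange.eval_nodal_derivative_eval_node_eq (s := Finset.univ) (v := y)
    (Finset.mem_univ i)
  rw [Lagrange.nodal] at this
  rw [derivative_C_mul, eval_mul, eval_C, this, Lagrange.eval_nodal]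

lemma exists_lt_neg_one_pow_mul_eval_pos (F : ℝ[X]) (hdeg : 0 < F.natDegree)
    (hl : 0 < F.leadingCoeff) (b : ℝ) :
    ∃ M < b, 0 < (-1 : ℝ) ^ F.natDegree * F.eval M := by
  set H : ℝ[X] := C ((-1) ^ F.natDegree) * F.comp (-X)
  have hc : ((-1 : ℝ) ^ F.natDegree) ≠ 0 := pow_ne_zero _ (by norm_num)
  have hnd : H.natDegree = F.natDegree := by
    rw [natDegree_C_mul hc, natDegree_comp, natDegree_neg, natDegree_X, mul_one]
  have hlc : H.leadingCoeff = F.leadingCoeff := by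
    rw [leadingCoeff_mul, leadingCoeff_C, leadingCoeff_comp (by simp), leadingCoeff_neg,
      leadingCoeff_X, mul_comm, mul_assoc, ← mul_pow]
    simp
  have ht := H.tendsto_atTop_of_leadingCoeff_nonneg
    (natDegree_pos_iff_degree_pos.1 (by omega)) (by rw [hlc]; exact hl.le)
  obtain ⟨x, hx, hxb⟩ :=
    ((ht.eventually_gt_atTop 0).and (Filter.eventually_gt_atTop (-b))).exists
  refine ⟨-x, by linarith, ?_⟩
  simpa [H, eval_comp] using hx

lemma eq_C_leadingCoeff_mul_prod {n : ℕ} {F : ℝ[X]} {y : Fin n → ℝ}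
    (hy : Function.Injective y) (hdeg : F.natDegree = n) (hF : F ≠ 0)
    (hr : ∀ i, F.eval (y i) = 0) :
    F = C F.leadingCoeff * ∏ i, (X - C (y i)) := by
  have hle : Finset.univ.val.map y ≤ F.roots :=
    (Multiset.le_iff_subset (Finset.univ.nodup.map hy)).2 fun r hr' => by
      obtain ⟨i, -, rfl⟩ := Multiset.mem_map.1 hr'
      exact (mem_roots hF).2 (hr i)
  have heq : Finset.univ.val.map y = F.roots :=
    Multiset.eq_of_le_of_card_le hle (by
      rw [Multiset.card_map, Finset.card_val, Finset.card_univ, Fintype.card_fin, ← hdeg]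
      exact card_roots' F)
  have hcard : Multiset.card F.roots = F.natDegree := by
    rw [← heq, Multiset.card_map, Finset.card_val, Finset.card_univ, Fintype.card_fin, hdeg]
  have := C_leadingCoeff_mul_prod_multiset_X_sub_C hcard
  rw [← heq, Multiset.map_map] at this
  exact this.symm

/-- Alternation of the signs of `F` along an increasing sequence ending at `0`. -/
lemma hasSimpleNegRoots_of_alternating {n : ℕ} {F : ℝ[X]} (hdeg : F.natDegree = n)
    (hl : 0 < F.leadingCoeff) {x : Fin (n + 1) → ℝ} (hx : StrictMono x)
    (hlast : x (Fin.last n) = 0)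
    (hs : ∀ i : Fin (n + 1), 0 < (-1 : ℝ) ^ (n - (i : ℕ)) * F.eval (x i)) :
    HasSimpleNegRoots n F := by
  have key : ∀ i : Fin n, ∃ r ∈ Set.Ioo (x i.castSucc) (x i.succ), F.eval r = 0 := by
    intro i
    have hlt : x i.castSucc < x i.succ := hx i.castSucc_lt_succ
    have h1 := hs i.castSucc
    have h2 := hs i.succ
    have hi := i.2
    rw [Fin.val_castSucc, show n - (i : ℕ) = (n - ((i : ℕ) + 1)) + 1 by omega] at h1
    rw [Fin.val_succ] at h2
    rw [pow_succ] at h1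
    have hcont : ContinuousOn (fun z => F.eval z) (Set.Icc (x i.castSucc) (x i.succ)) :=
      F.continuous.continuousOn
    rcases neg_one_pow_eq_or ℝ (n - ((i : ℕ) + 1)) with h | h <;> rw [h] at h1 h2
    · exact intermediate_value_Ioo hlt.le hcont ⟨by linarith, by linarith⟩
    · exact intermediate_value_Ioo' hlt.le hcont ⟨by linarith, by linarith⟩
  choose y hy hroot using key
  have hmono : StrictMono y := by
    intro i j hij
    have : x i.succ ≤ x j.castSucc := hx.monotone (by
      rw [Fin.le_def, Fin.val_succ, Fin.val_castSucc]
      exact hij)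
    linarith [(hy i).2, (hy j).1]
  refine ⟨F.leadingCoeff, hl, y, hmono, fun i => ?_, ?_⟩
  · have := hx.monotone (Fin.le_last i.succ)
    linarith [(hy i).2]
  · exact eq_C_leadingCoeff_mul_prod hmono.injective hdeg
      (by rintro rfl; simp at hl) hroot

/-- If `F` has the sign opposite to `G'` at the roots of `G`, then `F` inherits from `G` the
property of having only simple negative roots, with one root more. -/
lemma HasSimpleNegRoots.of_derivative_mul_neg {n : ℕ} {G F : ℝ[X]} (hG : HasSimpleNegRoots n G)
    (hdeg : F.natDegree = n + 1) (hl : 0 < F.leadingCoeff) (h0 : 0 < F.eval 0)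
    (h : ∀ r < 0, G.eval r = 0 → (derivative G).eval r * F.eval r < 0) :
    HasSimpleNegRoots (n + 1) F := by
  obtain ⟨c, hc, y, hy, hyn, rfl⟩ := hG
  obtain ⟨b, hb0, hb⟩ : ∃ b ≤ (0 : ℝ), ∀ i, b ≤ y i := by
    rcases isEmpty_or_nonempty (Fin n) with he | he
    · exact ⟨0, le_rfl, fun i => he.elim i⟩
    · obtain ⟨i, hi⟩ := Finite.exists_min y
      exact ⟨y i, (hyn i).le, hi⟩
  obtain ⟨M, hM, hMs⟩ := exists_lt_neg_one_pow_mul_eval_pos F (by omega) hl b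
  rw [hdeg] at hMs
  have hsign : ∀ i : Fin n, 0 < (-1 : ℝ) ^ (n - (i : ℕ)) * F.eval (y i) := by
    intro i
    have hr : (C c * ∏ j, (X - C (y j))).eval (y i) = 0 := by
      rw [eval_mul, eval_prod, Finset.prod_eq_zero (Finset.mem_univ i) (by simp), mul_zero]
    have h1 := h (y i) (hyn i) hr
    have h2 := neg_one_pow_mul_prod_sub_pos hy i
    have hi := i.2
    rw [eval_derivative_prod_X_sub_C] at h1
    -- The extra factor `-1` records that `F` and `G'` have opposite signs at `y i`.
    rw [show n - (i : ℕ) = (n - 1 - (i : ℕ)) + 1 by omega, pow_succ]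
    set P := ∏ j ∈ Finset.univ.erase i, (y i - y j)
    have h3 : P * F.eval (y i) < 0 := by
      rw [mul_assoc] at h1
      exact (pos_iff_neg_of_mul_neg h1).1 hc
    rcases neg_one_pow_eq_or ℝ (n - 1 - (i : ℕ)) with e | e <;> rw [e] at h2 ⊢
    · have := (pos_iff_neg_of_mul_neg h3).1 (by linarith)
      linarith
    · have := (neg_iff_pos_of_mul_neg h3).1 (by linarith)
      linarith
  -- The `n + 2` nodes `M < y 0 < ⋯ < y (n-1) < 0` bound the `n + 1` intervals that each contain one
  -- root of `F`.
  refine hasSimpleNegRoots_of_alternating (x := Fin.cons M (Fin.snoc y 0)) hdeg hl ?_ ?_ ?_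
  · intro i j
    refine Fin.cases ?_ (fun i => ?_) i <;> refine Fin.cases ?_ (fun j => ?_) j
    · intro hij; exact absurd hij (lt_irrefl _)
    · intro _
      refine Fin.lastCases ?_ (fun j => ?_) j
      · simp; linarith
      · simp; linarith [hb j]
    · intro hij; exact absurd hij (Fin.not_lt_zero _)
    · refine Fin.lastCases ?_ (fun i => ?_) i <;> refine Fin.lastCases ?_ (fun j => ?_) j
      · intro hij; exact absurd hij (lt_irrefl _)
      · intro hij
        have := Fin.le_last j.castSucc
        exact absurd (Fin.succ_lt_succ_iff.1 hij) (not_lt.2 this)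
      · intro _; simpa using hyn i
      · intro hij
        simpa using hy (by simpa using hij)
  · simp [← Fin.succ_last]
  · intro i
    refine Fin.cases ?_ (fun i => ?_) i
    · simpa using hMs
    · refine Fin.lastCases ?_ (fun i => ?_) i
      · simpa using h0
      · simpa using hsign i

lemma HasSimpleNegRoots.eval_derivative_ne_zero {n : ℕ} {G : ℝ[X]} (hG : HasSimpleNegRoots n G)
    {r : ℝ} (h : G.eval r = 0) : (derivative G).eval r ≠ 0 := by
  obtain ⟨c, hc, y, hy, -, rfl⟩ := hG
  rw [eval_mul, eval_C, eval_prod, mul_eq_zero, Finset.prod_eq_zero_iff] at h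
  obtain ⟨i, -, hi⟩ := h.resolve_left hc.ne'
  rw [eval_sub, eval_X, eval_C, sub_eq_zero] at hi
  rw [hi, eval_derivative_prod_X_sub_C]
  exact mul_ne_zero hc.ne' (right_ne_zero_of_mul (neg_one_pow_mul_prod_sub_pos hy i).ne')

/-! ### Hypergeometric polynomials and their roots. -/

lemma succ_mul_ringChoose_succ (r : ℝ) (m : ℕ) :
    ((m : ℝ) + 1) * Ring.choose r (m + 1) = (r - m) * Ring.choose r m := by
  have := Ring.choose_smul_choose r (Nat.le_succ m)
  rw [Nat.succ_eq_add_one, Nat.choose_succ_self_right, Nat.add_sub_cancel_left,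
    Ring.choose_one_right, nsmul_eq_mul] at this
  push_cast at this
  linarith

lemma ringChoose_pos {r : ℝ} {m : ℕ} (h : (m : ℝ) - 1 < r) : 0 < Ring.choose r m := by
  induction m with
  | zero => simp
  | succ m ih =>
    push_cast at h
    have h1 := succ_mul_ringChoose_succ r m
    have h2 : 0 < (r - m) * Ring.choose r m := mul_pos (by linarith) (ih (by linarith))
    rw [← h1] at h2
    exact (pos_iff_pos_of_mul_pos h2).1 (by positivity)

/-- The polynomial `∑ s, C(p, n-s) C(q, s) z^s`. For `p = n + a` and `q = n + b` it is the Jacobi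
polynomial `P_n^{(a,b)}` in the variable `z = (x-1)/(x+1)`, up to the factor `((x+1)/2)^n`. -/
noncomputable def jacobiRev (n : ℕ) (p q : ℝ) : ℝ[X] :=
  ∑ s ∈ Finset.range (n + 1), monomial s (Ring.choose p (n - s) * Ring.choose q s)

lemma coeff_jacobiRev (n : ℕ) (p q : ℝ) (s : ℕ) :
    (jacobiRev n p q).coeff s = if s ≤ n then Ring.choose p (n - s) * Ring.choose q s else 0 := by
  simp only [jacobiRev, finsetSum_coeff, coeff_monomial, Finset.sum_ite_eq', Finset.mem_range,
    Nat.lt_succ_iff]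

lemma coeff_jacobiRev_pos {n : ℕ} {p q : ℝ} (hp : (n : ℝ) - 1 < p) (hq : (n : ℝ) - 1 < q)
    {s : ℕ} (hs : s ≤ n) : 0 < (jacobiRev n p q).coeff s := by
  rw [coeff_jacobiRev, if_pos hs]
  have h1 : ((n - s : ℕ) : ℝ) ≤ n := by exact_mod_cast Nat.sub_le n s
  have h2 : (s : ℝ) ≤ n := by exact_mod_cast hs
  exact mul_pos (ringChoose_pos (by linarith)) (ringChoose_pos (by linarith))

lemma natDegree_jacobiRev {n : ℕ} {p q : ℝ} (hp : (n : ℝ) - 1 < p) (hq : (n : ℝ) - 1 < q) :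
    (jacobiRev n p q).natDegree = n := by
  refine natDegree_eq_of_le_of_coeff_ne_zero ?_ (coeff_jacobiRev_pos hp hq le_rfl).ne'
  rw [natDegree_le_iff_coeff_eq_zero]
  intro s hs
  rw [coeff_jacobiRev, if_neg (by omega)]

lemma leadingCoeff_jacobiRev_pos {n : ℕ} {p q : ℝ} (hp : (n : ℝ) - 1 < p)
    (hq : (n : ℝ) - 1 < q) : 0 < (jacobiRev n p q).leadingCoeff := by
  rw [leadingCoeff, natDegree_jacobiRev hp hq]
  exact coeff_jacobiRev_pos hp hq le_rfl

lemma eval_zero_jacobiRev_pos {n : ℕ} {p q : ℝ} (hp : (n : ℝ) - 1 < p)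
    (hq : (n : ℝ) - 1 < q) : 0 < (jacobiRev n p q).eval 0 := by
  rw [← coeff_zero_eq_eval_zero]
  exact coeff_jacobiRev_pos hp hq (Nat.zero_le n)

lemma coeff_jacobiRev_mul (n : ℕ) (p q : ℝ) (s : ℕ) :
    (p - n + s) * (jacobiRev n p q).coeff s = (n + 1 - s) * (jacobiRev (n + 1) p q).coeff s := by
  rw [coeff_jacobiRev, coeff_jacobiRev]
  rcases lt_trichotomy s (n + 1) with h | rfl | h
  · obtain ⟨t, rfl⟩ := Nat.exists_eq_add_of_le (Nat.lt_succ_iff.1 h)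
    rw [if_pos (by omega), if_pos (by omega), show s + t - s = t by omega,
      show s + t + 1 - s = t + 1 by omega]
    have := succ_mul_ringChoose_succ p t
    push_cast
    linear_combination (-Ring.choose q s) * this
  · rw [if_neg (by omega)]
    push_cast
    ring
  · rw [if_neg (by omega), if_neg (by omega)]
    ring

lemma coeff_jacobiRev_mul' (n : ℕ) (p q : ℝ) (s : ℕ) :
    (q - s) * (jacobiRev n p q).coeff s =
      (s + 1) * (jacobiRev (n + 1) p q).coeff (s + 1) := by
  rw [coeff_jacobiRev, coeff_jacobiRev]
  by_cases h : s ≤ n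
  · rw [if_pos h, if_pos (by omega), show n + 1 - (s + 1) = n - s by omega]
    linear_combination (-Ring.choose p (n - s)) * succ_mul_ringChoose_succ q s
  · rw [if_neg h, if_neg (by omega)]
    ring

lemma coeff_succ_jacobiRev (n : ℕ) (p q : ℝ) (s : ℕ) :
    (p - n + s + 1) * (s + 1) * (jacobiRev n p q).coeff (s + 1) =
      (n - s) * (q - s) * (jacobiRev n p q).coeff s := by
  rw [coeff_jacobiRev, coeff_jacobiRev]
  rcases lt_trichotomy s n with h | rfl | h
  · obtain ⟨t, rfl⟩ := Nat.exists_eq_add_of_lt h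
    rw [if_pos (by omega), if_pos (by omega), show s + t + 1 - (s + 1) = t by omega,
      show s + t + 1 - s = t + 1 by omega]
    have h1 := succ_mul_ringChoose_succ p t
    have h2 := succ_mul_ringChoose_succ q s
    push_cast
    linear_combination (p - t) * Ring.choose p t * h2 - (q - s) * Ring.choose q s * h1
  · rw [if_neg (by omega)]
    ring
  · rw [if_neg (by omega), if_neg (by omega)]
    ring

/-- Raises the degree with `p`, `q` fixed. At a root of the degree `n` polynomial the right side
collapses to `z (1 - z)` times its derivative, which is the sign condition for the induction. -/
lemma jacobiRev_succ (n : ℕ) (p q : ℝ) :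
    C ((n : ℝ) + 1) * jacobiRev (n + 1) p q =
      C (p - n) * jacobiRev n p q + X * derivative (jacobiRev n p q) +
        X * (C q * jacobiRev n p q - X * derivative (jacobiRev n p q)) := by
  ext s
  have h1 := coeff_jacobiRev_mul n p q s
  rcases s with _ | s
  · simp only [coeff_add, coeff_C_mul, coeff_X_mul_zero]
    push_cast at h1
    linarith
  · have h2 := coeff_jacobiRev_mul' n p q s
    have h3 : (X * derivative (jacobiRev n p q)).coeff s = s * (jacobiRev n p q).coeff s := by
      rcases s with _ | s
      · simp
      · rw [coeff_X_mul, coeff_derivative]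
        push_cast
        ring
    simp only [coeff_add, coeff_sub, coeff_C_mul, coeff_X_mul, coeff_derivative, h3]
    push_cast at h1
    linear_combination (-1 : ℝ) * h1 - h2

/-- Gauss's hypergeometric equation, equivalent to the two-term recurrence `coeff_succ_jacobiRev`.
-/
lemma jacobiRev_differential_equation (n : ℕ) (p q : ℝ) :
    X * derivative (derivative (jacobiRev n p q)) +
        C (1 + p - n) * derivative (jacobiRev n p q) =
      X * (X * derivative (derivative (jacobiRev n p q))) -
        C (n + q - 1) * (X * derivative (jacobiRev n p q)) + C (n * q) * jacobiRev n p q := by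
  ext s
  have h := coeff_succ_jacobiRev n p q s
  rcases s with _ | _ | s <;>
    simp only [coeff_add, coeff_sub, coeff_C_mul, coeff_X_mul, coeff_X_mul_zero,
      coeff_derivative] <;> push_cast at h ⊢ <;> linear_combination h

lemma hasSimpleNegRoots_jacobiRev (n : ℕ) {p q : ℝ} (hp : (n : ℝ) - 1 < p)
    (hq : (n : ℝ) - 1 < q) : HasSimpleNegRoots n (jacobiRev n p q) := by
  induction n with
  | zero =>
    refine ⟨1, one_pos, Fin.elim0, fun i => i.elim0, fun i => i.elim0, ?_⟩
    simp [jacobiRev]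
  | succ n ih =>
    have hp' : (n : ℝ) - 1 < p := by push_cast at hp; linarith
    have hq' : (n : ℝ) - 1 < q := by push_cast at hq; linarith
    refine (ih hp' hq').of_derivative_mul_neg (natDegree_jacobiRev hp hq)
      (leadingCoeff_jacobiRev_pos hp hq) (eval_zero_jacobiRev_pos hp hq) fun r hr h => ?_
    have h1 := congrArg (eval r) (jacobiRev_succ n p q)
    simp only [eval_add, eval_sub, eval_mul, eval_C, eval_X, h] at h1
    have h2 : 0 < (derivative (jacobiRev n p q)).eval r ^ 2 :=
      sq_pos_of_ne_zero ((ih hp' hq').eval_derivative_ne_zero h)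
    have h3 : ((n : ℝ) + 1) * ((derivative (jacobiRev n p q)).eval r *
        (jacobiRev (n + 1) p q).eval r) < 0 := by
      calc _ = r * (1 - r) * (derivative (jacobiRev n p q)).eval r ^ 2 := by
            linear_combination (derivative (jacobiRev n p q)).eval r * h1
        _ < 0 := mul_neg_of_neg_of_pos (mul_neg_of_neg_of_pos hr (by linarith)) h2
    exact (pos_iff_neg_of_mul_neg h3).1 (by positivity)

/-! ### The Wronskian and the sign of `B' A`. -/

/-- The equation reads `(s+1) u_{s+1} = (s-m) u_s` on coefficients, so the constant term determines
`U`. -/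
lemma eq_zero_of_one_sub_X_mul_derivative {m : ℕ} {U : ℝ[X]}
    (h : (1 - X) * derivative U + C (m : ℝ) * U = 0) (h0 : U.eval 0 = 0) : U = 0 := by
  ext s
  rw [coeff_zero]
  induction s with
  | zero => rwa [coeff_zero_eq_eval_zero]
  | succ s ih =>
    have h1 := congrArg (fun P => coeff P s) h
    have h3 : (X * derivative U).coeff s = s * U.coeff s := by
      rcases s with _ | s
      · simp
      · rw [coeff_X_mul, coeff_derivative]
        push_cast
        ring
    simp only [sub_mul, one_mul, coeff_add, coeff_sub, coeff_C_mul, coeff_derivative, h3, ih,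
      coeff_zero, mul_zero, add_zero, sub_zero] at h1
    exact (mul_eq_zero.1 h1).resolve_right (by positivity)

lemma eq_C_mul_one_sub_X_pow {m : ℕ} {U : ℝ[X]}
    (h : (1 - X) * derivative U + C (m : ℝ) * U = 0) : U = C (U.eval 0) * (1 - X) ^ m := by
  rw [← sub_eq_zero]
  refine eq_zero_of_one_sub_X_mul_derivative (m := m) ?_ (by simp)
  rcases m with _ | m
  · simp only [Nat.cast_zero, C_0, zero_mul, add_zero] at h ⊢
    simpa using h
  · simp only [derivative_sub, derivative_C_mul, derivative_pow, derivative_one, derivative_X,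
      Nat.add_sub_cancel]
    linear_combination h

/-- The Wronskian of the two polynomials attached to `P_{m+1}^{(-b,b-1)}` and `P_m^{(b,1-b)}`. -/
lemma jacobiRev_wronskian (m : ℕ) (b : ℝ) :
    let A := jacobiRev (m + 1) (m + 1 - b) (m + b)
    let B := jacobiRev m (m + b) (m + 1 - b)
    C b * (A * B) + X * (derivative B * A - B * derivative A) =
      C (b * (A.eval 0 * B.eval 0)) * (1 - X) ^ (2 * m + 1) := by
  intro A B
  have hA := jacobiRev_differential_equation (m + 1) (m + 1 - b) (m + b)
  have hB := jacobiRev_differential_equation m (m + b) (m + 1 - b)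
  change X * derivative (derivative A) + _ * derivative A = X * (X * derivative (derivative A)) -
    _ * (X * derivative A) + _ * A at hA
  change X * derivative (derivative B) + _ * derivative B = X * (X * derivative (derivative B)) -
    _ * (X * derivative B) + _ * B at hB
  have := eq_C_mul_one_sub_X_pow (m := 2 * m + 1)
    (U := C b * (A * B) + X * (derivative B * A - B * derivative A)) (by
      simp only [derivative_add, derivative_sub, derivative_mul, derivative_C, derivative_X]
      push_cast at hA hB ⊢
      simp only [C_add, C_sub, C_mul, C_1, show (C (2 : ℝ) : ℝ[X]) = 2 from rfl] at hA hB ⊢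
      -- Eliminating the second derivatives leaves Abel's first-order equation for `U`, the
      -- Wronskian of `A` and `z^b B` times `z^(1-b)`.
      linear_combination A * hB - B * hA)
  rw [this]
  simp

/-- At a root `r` of `B` the Wronskian identity reduces to `r B'(r) A(r) = b A(0) B(0) (1-r)^(2m+1)
> 0`. -/
lemma derivative_jacobiRev_mul_neg {m : ℕ} {b : ℝ} (hb0 : 0 < b) (hb1 : b < 1) {r : ℝ}
    (hr : r < 0) (h : (jacobiRev m (m + b) (m + 1 - b)).eval r = 0) :
    (derivative (jacobiRev m (m + b) (m + 1 - b))).eval r *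
      (jacobiRev (m + 1) (m + 1 - b) (m + b)).eval r < 0 := by
  have hw := congrArg (eval r) (jacobiRev_wronskian m b)
  have hA : 0 < (jacobiRev (m + 1) (m + 1 - b) (m + b)).eval 0 :=
    eval_zero_jacobiRev_pos (by push_cast; linarith) (by push_cast; linarith)
  have hB : 0 < (jacobiRev m (m + b) (m + 1 - b)).eval 0 :=
    eval_zero_jacobiRev_pos (by linarith) (by linarith)
  simp only [eval_add, eval_sub, eval_mul, eval_C, eval_X, eval_pow, eval_one, h] at hw
  have : 0 < r * ((derivative (jacobiRev m (m + b) (m + 1 - b))).eval r *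
      (jacobiRev (m + 1) (m + 1 - b) (m + b)).eval r) := by
    have h1 : 0 < (1 - r) ^ (2 * m + 1) := pow_pos (by linarith) _
    calc 0 < _ := mul_pos (mul_pos hb0 (mul_pos hA hB)) h1
      _ = _ := by rw [← hw]; ring
  exact (neg_iff_neg_of_mul_pos this).1 hr

/-! ### Consequences of having simple negative roots. -/

lemma HasSimpleNegRoots.natDegree_eq {n : ℕ} {F : ℝ[X]} (hF : HasSimpleNegRoots n F) :
    F.natDegree = n := by
  obtain ⟨c, hc, y, -, -, rfl⟩ := hF
  rw [natDegree_C_mul hc.ne', natDegree_prod_of_monic _ _ fun i _ => monic_X_sub_C _]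
  simp

lemma HasSimpleNegRoots.leadingCoeff_pos {n : ℕ} {F : ℝ[X]} (hF : HasSimpleNegRoots n F) :
    0 < F.leadingCoeff := by
  obtain ⟨c, hc, y, -, -, rfl⟩ := hF
  rw [leadingCoeff_mul, leadingCoeff_C,
    (monic_prod_of_monic _ _ fun i _ => monic_X_sub_C (y i)).leadingCoeff, mul_one]
  exact hc

lemma HasSimpleNegRoots.eval_zero_pos {n : ℕ} {F : ℝ[X]} (hF : HasSimpleNegRoots n F) :
    0 < F.eval 0 := by
  obtain ⟨c, hc, y, -, hy, rfl⟩ := hF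
  rw [eval_mul, eval_C, eval_prod]
  refine mul_pos hc (Finset.prod_pos fun i _ => ?_)
  simpa using hy i

lemma HasSimpleNegRoots.roots_map_complex {n : ℕ} {F : ℝ[X]} (hF : HasSimpleNegRoots n F) :
    ∃ y : Fin n → ℝ, StrictMono y ∧ (∀ i, y i < 0) ∧
      (F.map (algebraMap ℝ ℂ)).roots = Finset.univ.val.map fun i => (y i : ℂ) := by
  obtain ⟨c, hc, y, hy, hyn, rfl⟩ := hF
  refine ⟨y, hy, hyn, ?_⟩
  have : (C c * ∏ i, (X - C (y i))).map (algebraMap ℝ ℂ) =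
      C (c : ℂ) * (Multiset.map (fun a => X - C a)
        (Finset.univ.val.map fun i => (y i : ℂ))).prod := by
    rw [Polynomial.map_mul, Polynomial.map_C, Polynomial.map_prod, Multiset.map_map]
    simp [Finset.prod]
  rw [this, roots_C_mul _ (by exact_mod_cast hc.ne'), roots_multiset_prod_X_sub_C]

/-! ### Back to the Jacobi polynomials. -/

lemma eval_jacobiPoly (n : ℕ) (a b x r : ℝ) (h : x - 1 = r * (x + 1)) :
    (jacobiPoly n a b).eval x = ((x + 1) / 2) ^ n * (jacobiRev n (n + a) (n + b)).eval r := by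
  rw [jacobiPoly, jacobiRev, eval_finsetSum, eval_finsetSum, Finset.mul_sum]
  refine Finset.sum_congr rfl fun s hs => ?_
  have hs' : s ≤ n := Nat.lt_succ_iff.1 (Finset.mem_range.1 hs)
  simp only [eval_mul, eval_C, eval_pow, eval_sub, eval_add, eval_X, eval_one, eval_monomial]
  rw [h, show ((x + 1) / 2) ^ n = ((x + 1) / 2) ^ s * ((x + 1) / 2) ^ (n - s) by
    rw [← pow_add, Nat.add_sub_cancel' hs'],
    show 1 / 2 * (r * (x + 1)) = r * ((x + 1) / 2) by ring, mul_pow]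
  ring

lemma natDegree_jacobiPoly_le (n : ℕ) (a b : ℝ) : (jacobiPoly n a b).natDegree ≤ n := by
  refine natDegree_sum_le_of_forall_le _ _ fun s hs => ?_
  have hs' : s ≤ n := Nat.lt_succ_iff.1 (Finset.mem_range.1 hs)
  have h1 : (C (1 / 2 : ℝ) * (X - 1)).natDegree ≤ 1 := by compute_degree
  have h2 : (C (1 / 2 : ℝ) * (X + 1)).natDegree ≤ 1 := by compute_degree
  have := natDegree_mul_le_of_le (natDegree_mul_le_of_le
    (natDegree_C (Ring.choose ((n : ℝ) + a) (n - s) * Ring.choose ((n : ℝ) + b) s)).le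
    (natDegree_pow_le_of_le s h1)) (natDegree_pow_le_of_le (n - s) h2)
  refine this.trans ?_
  omega

/-- The map `y ↦ (1+y)/(1-y)` inverts the substitution; `n` distinct roots exhaust a nonzero
polynomial of degree at most `n`. -/
lemma roots_jacobiPoly {n : ℕ} {a b : ℝ} (ha : -1 < a) {y : Fin n → ℝ}
    (hy : StrictMono y) (hyn : ∀ i, y i < 0)
    (hr : ∀ i, (jacobiRev n (n + a) (n + b)).eval (y i) = 0) :
    (jacobiPoly n a b).roots = Finset.univ.val.map fun i => (1 + y i) / (1 - y i) := by
  have hJ : jacobiPoly n a b ≠ 0 := by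
    intro h
    -- The value at `x = 1` is `C(n+a, n)`, positive because `a > -1`.
    have h1 := eval_jacobiPoly n a b 1 0 (by ring)
    rw [h, ← coeff_zero_eq_eval_zero, coeff_jacobiRev, if_pos (Nat.zero_le n), Nat.sub_zero,
      Ring.choose_zero_right, mul_one] at h1
    have : 0 < Ring.choose ((n : ℝ) + a) n := ringChoose_pos (by linarith)
    norm_num at h1
    exact this.ne h1
  have hinj : Function.Injective fun i => (1 + y i) / (1 - y i) := by
    intro i j hij
    have h1 := hyn i
    have h2 := hyn j
    have h3 : 1 - y i ≠ 0 := by linarith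
    have h4 : 1 - y j ≠ 0 := by linarith
    simp only at hij
    rw [div_eq_div_iff h3 h4] at hij
    exact hy.injective (by linarith)
  refine (Multiset.eq_of_le_of_card_le ((Multiset.le_iff_subset
    (Finset.univ.nodup.map hinj)).2 fun r hr' => ?_) ?_).symm
  · obtain ⟨i, -, rfl⟩ := Multiset.mem_map.1 hr'
    have h3 : 1 - y i ≠ 0 := by linarith [hyn i]
    rw [mem_roots hJ, IsRoot.def, eval_jacobiPoly n a b _ (y i) (by field_simp; ring), hr i,
      mul_zero]
  · rw [Multiset.card_map, Finset.card_val, Finset.card_univ, Fintype.card_fin]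
    exact (card_roots' _).trans (natDegree_jacobiPoly_le n a b)

/-- The monic polynomial whose roots are the opposites of the images under `poleMap τ` of the zeros
of a Jacobi polynomial. -/
lemma prod_X_add_poleMap_roots {n : ℕ} {a b τ : ℝ} (ha : -1 < a) (hb : -1 < b) (hτ : 0 < τ) :
    let S := (jacobiPoly n a b).roots.map (poleMap τ)
    0 < S.prod ∧ HasSimpleNegRoots n (S.map fun e => X + C e).prod ∧
      ∃ c : ℝ, 0 < c ∧ (S.map fun e => X + C e).prod =
        C c * (jacobiRev n (n + a) (n + b)).comp (C τ⁻¹ * X) := by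
  intro S
  obtain ⟨c, hc, y, hy, hyn, hR⟩ := hasSimpleNegRoots_jacobiRev n
    (p := n + a) (q := n + b) (by linarith) (by linarith)
  have hroot : ∀ i, (jacobiRev n (n + a) (n + b)).eval (y i) = 0 := by
    intro i
    rw [hR, eval_mul, eval_prod, Finset.prod_eq_zero (Finset.mem_univ i) (by simp), mul_zero]
  have hS : S = Finset.univ.val.map fun i => -(τ * y i) := by
    simp only [S]
    rw [roots_jacobiPoly ha hy hyn hroot, Multiset.map_map]
    refine Multiset.map_congr rfl fun i _ => ?_
    have h3 : 1 - y i ≠ 0 := by linarith [hyn i]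
    simp only [Function.comp, poleMap]
    rw [show 1 + (1 + y i) / (1 - y i) = 2 / (1 - y i) by field_simp; ring,
      show 1 - (1 + y i) / (1 - y i) = -2 * y i / (1 - y i) by field_simp; ring]
    field_simp
  have hprod : (S.map fun e => X + C e).prod = ∏ i, (X - C (τ * y i)) := by
    rw [hS, Multiset.map_map]
    simp [Finset.prod, sub_eq_add_neg]
  rw [hprod]
  -- In `τ ^ n / c`, each linear factor contributes a `τ`, and `c` is the leading coefficient of
  -- `jacobiRev`.
  refine ⟨?_, ⟨1, one_pos, fun i => τ * y i, fun i j hij => ?_, fun i => ?_, by simp⟩,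
    τ ^ n / c, by positivity, ?_⟩
  · rw [hS]
    refine Finset.prod_pos (f := fun i => -(τ * y i)) fun i _ => ?_
    nlinarith [hyn i]
  · exact mul_lt_mul_of_pos_left (hy hij) hτ
  · exact mul_neg_of_pos_of_neg hτ (hyn i)
  · have hfac : ∀ i, X - C (τ * y i) = C τ * (C τ⁻¹ * X - C (y i)) := by
      intro i
      rw [mul_sub, ← mul_assoc, ← C_mul, ← C_mul, mul_inv_cancel₀ hτ.ne', C_1, one_mul]
    simp only [hR, hfac, mul_comp, C_comp, Polynomial.prod_comp, sub_comp, X_comp]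
    rw [Finset.prod_mul_distrib, Finset.prod_const, Finset.card_univ, Fintype.card_fin,
      ← mul_assoc, ← C_mul, div_mul_cancel₀ _ hc.ne', C_pow]

/-! ### The polynomial p + νq and its poles. -/

lemma hasSimpleNegRoots_qTilde {α τ ν : ℝ} (m : ℕ) (hα0 : 0 < α) (hα2 : α < 2) (hτ : 0 < τ)
    (hν : 0 < ν) : HasSimpleNegRoots (m + 1) (qTilde α τ ν (m + 1)) := by
  obtain ⟨hη, hq, c, hc, hqc⟩ := prod_X_add_poleMap_roots (n := m + 1) (a := -(α / 2))
    (b := α / 2 - 1) (τ := τ) (by linarith) (by linarith) hτ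
  obtain ⟨hε, hp, d, hd, hpd⟩ := prod_X_add_poleMap_roots (n := m) (a := α / 2)
    (b := 1 - α / 2) (τ := τ) (by linarith) (by linarith) hτ
  change 0 < (etas α τ (m + 1)).prod at hη
  change 0 < (epsilons α τ (m + 1)).prod at hε
  change HasSimpleNegRoots (m + 1) (qPoly α τ (m + 1)) at hq
  change qPoly α τ (m + 1) = _ at hqc
  have hχ : 0 < chi α τ (m + 1) := by
    have h1 : 0 < Ring.choose (((m + 1 : ℕ) : ℝ) + α / 2 - 1) m :=
      ringChoose_pos (by push_cast; linarith)
    have h2 : 0 < Ring.choose (((m + 1 : ℕ) : ℝ) - α / 2) (m + 1) :=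
      ringChoose_pos (by push_cast; linarith)
    have h3 := Real.rpow_pos_of_pos hτ (α / 2)
    exact mul_pos (mul_pos (one_div_pos.2 h3) (div_pos h1 h2)) (div_pos hη hε)
  have hpc : pPoly α τ (m + 1) = C (chi α τ (m + 1)) * (C d *
      (jacobiRev m (m + α / 2) (m + (1 - α / 2))).comp (C τ⁻¹ * X)) := by
    rw [← hpd]
    rfl
  have hpP : HasSimpleNegRoots m (pPoly α τ (m + 1)) := by
    obtain ⟨e, he, y, hy, hyn, h⟩ := hp
    refine ⟨chi α τ (m + 1) * e, mul_pos hχ he, y, hy, hyn, ?_⟩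
    rw [C_mul, mul_assoc, ← h]
    rfl
  have hνq : (C ν * qPoly α τ (m + 1)).natDegree = m + 1 := by
    rw [natDegree_C_mul hν.ne', hq.natDegree_eq]
  have hlt : (pPoly α τ (m + 1)).natDegree < (C ν * qPoly α τ (m + 1)).natDegree := by
    rw [hνq, hpP.natDegree_eq]
    exact Nat.lt_succ_self m
  refine hpP.of_derivative_mul_neg ?_ ?_ ?_ fun r hr h => ?_
  · rw [qTilde, natDegree_add_eq_right_of_natDegree_lt hlt, hνq]
  · rw [qTilde, leadingCoeff_add_of_degree_lt (degree_lt_degree hlt), leadingCoeff_mul,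
      leadingCoeff_C]
    exact mul_pos hν hq.leadingCoeff_pos
  · rw [qTilde, eval_add, eval_mul, eval_C]
    exact add_pos hpP.eval_zero_pos (mul_pos hν hq.eval_zero_pos)
  -- Since p vanishes at `r`, the product is a positive multiple of `B' A` at `r/τ`.
  · rw [qTilde, eval_add, h, zero_add, hqc, hpc]
    rw [hpc] at h
    simp only [derivative_C_mul, derivative_comp, derivative_X, eval_mul, eval_C, eval_comp,
      eval_X, mul_one, mul_eq_zero, hχ.ne', hd.ne', false_or] at h ⊢
    have hbm : (m : ℝ) + (1 - α / 2) = m + 1 - α / 2 := by ring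
    have ham : ((m + 1 : ℕ) : ℝ) + (α / 2 - 1) = m + α / 2 := by push_cast; ring
    have ham' : ((m + 1 : ℕ) : ℝ) + -(α / 2) = m + 1 - α / 2 := by push_cast; ring
    rw [hbm] at h ⊢
    rw [ham, ham']
    have hneg := derivative_jacobiRev_mul_neg (m := m) (b := α / 2) (by linarith) (by linarith)
      (r := τ⁻¹ * r) (mul_neg_of_pos_of_neg (inv_pos.2 hτ) hr) h
    have hpos : 0 < chi α τ (m + 1) * d * τ⁻¹ * ν * c := by positivity
    calc _ = _ := by ring
      _ < 0 := mul_neg_of_pos_of_neg hpos hneg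

theorem proposition1 (α τ ν : ℝ) (k : ℕ) (hα0 : 0 < α) (hα2 : α < 2) (hτ : 0 < τ) (hν : 0 < ν)
    (hk : 1 ≤ k) :
    (qTilde α τ ν k).natDegree = k ∧
    (∀ z : ℂ, ((qTilde α τ ν k).map (algebraMap ℝ ℂ)).IsRoot z →
      z.im = 0 ∧ z.re < 0 ∧
        ((qTilde α τ ν k).map (algebraMap ℝ ℂ)).rootMultiplicity z = 1) ∧
    (Multiset.card (krylovPoles α τ ν k) = k ∧ (krylovPoles α τ ν k).Nodup ∧
      ∀ ξ ∈ krylovPoles α τ ν k, ξ.im = 0 ∧ 0 < ξ.re) := by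
  obtain ⟨m, rfl⟩ := Nat.exists_eq_add_of_le' hk
  have hF := hasSimpleNegRoots_qTilde m hα0 hα2 hτ hν
  obtain ⟨y, hy, hyn, hroots⟩ := hF.roots_map_complex
  have hnodup : ((qTilde α τ ν (m + 1)).map (algebraMap ℝ ℂ)).roots.Nodup := by
    rw [hroots]
    exact Finset.univ.nodup.map (Complex.ofReal_injective.comp hy.injective)
  have hne : (qTilde α τ ν (m + 1)).map (algebraMap ℝ ℂ) ≠ 0 :=
    (Polynomial.map_ne_zero_iff (algebraMap ℝ ℂ).injective).2
      (leadingCoeff_ne_zero.1 hF.leadingCoeff_pos.ne')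
  have hneg : ∀ z ∈ ((qTilde α τ ν (m + 1)).map (algebraMap ℝ ℂ)).roots,
      z.im = 0 ∧ z.re < 0 := by
    intro z hz
    rw [hroots] at hz
    obtain ⟨i, -, rfl⟩ := Multiset.mem_map.1 hz
    exact ⟨Complex.ofReal_im _, by simpa using hyn i⟩
  refine ⟨hF.natDegree_eq, fun z hz => ?_, ?_, hnodup.map neg_injective, fun ξ hξ => ?_⟩
  · have hmem := (mem_roots hne).2 hz
    refine ⟨(hneg z hmem).1, (hneg z hmem).2, ?_⟩
    rw [← count_roots]
    exact Multiset.count_eq_one_of_mem hnodup hmem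
  · rw [krylovPoles, Multiset.card_map, hroots]
    simp
  · obtain ⟨z, hz, rfl⟩ := Multiset.mem_map.1 hξ
    simpa using hneg z hz
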